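/- Let $D$ be an (oriented) virtual link diagram, i.e. a family of oriented closed curves generically immersed in the plane, each of whose finitely many transverse double points is either a real crossing (with over/under information) or a virtual crossing. Let $(\Sigma, D_\Sigma)$ be the abstract link diagram associated with $D$: the ribbon surface obtained by taking a disc around each real crossing, joining these discs by untwisted bands along the arcs of $D$ (bands pass through virtual crossings without meeting), and taking an annulus for each component without real crossings, together with the link diagram $D_\Sigma$ formed by the cores. Let $F$ be a closed surface, possibly non-orientable, and let $(F, D_F)$ be a link diagram realization of $D$, i.e. $D_F=f(D_\Sigma)$ for an embedding $f:\Sigma\to F$. A surface pole state $s$ of $(F,D_F)$ is obtained by applying an A-splice or a B-splice at each real crossing of $D_F$. It is a collection of disjoint simple closed curves in $F$. At each crossing whose splice does not respect the orientation of $D_F$ (B-splice at a positive crossing, A-splice at a negative one), the arc joining the two incoming ends carries a sink pole and the arc joining the two outgoing ends carries a source pole, each pole lying on the side of its arc that faces the other arc. A pole reduction removes from a pole curve two poles, a sink and a source, that are adjacent on the curve and lie on the same side of it. A pole curve is irreducible if no pole reduction applies, and the index $\iota(l)$ of a pole curve $l$ is half of the number of poles of an irreducible pole curve obtained from $l$ by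 pole reductions. Let $l$ be a pole curve of a surface pole state $s$ of $(F,D_F)$. If $\iota(l)>0$, then $l$ is not a separating curve in $F$, i.e. the complement of $l$ in the connected component of $F$ that contains $l$ is connected. -/

import Mathlib

open scoped ContDiff

/-! ## Gauss data and the surface of an abstract link diagram -/

/-- The Gauss diagram of an oriented virtual link diagram. A passage `(c, b)` is the passage of the
link through the real crossing `c` along its over strand (`b = true`) or under strand
(`b = false`). `next p` is the passage which follows `p` along the oriented link, `positive c`
says whether `c` is a positive crossing, and `Loop` indexes the components of the link that pass
through no real crossing. -/
structure GaussDiagram where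
  Crossing : Type
  [fintypeCrossing : Fintype Crossing]
  next : Equiv.Perm (Crossing × Bool)
  positive : Crossing → Bool
  Loop : Type
  [fintypeLoop : Fintype Loop]

namespace GaussDiagram

attribute [instance] GaussDiagram.fintypeCrossing GaussDiagram.fintypeLoop

/-- The plaque around a crossing: the square `[-1, 1]²` without its four corners (a cross-shaped
neighbourhood of the crossing, with four ends). The two strands are the segments on the coordinate
axes, both oriented in the direction of increasing coordinate. -/
abbrev Plaque : Type :=
  {z : ℝ × ℝ // |z.1| ≤ 1 ∧ |z.2| ≤ 1 ∧ (|z.1| < 1 ∨ |z.2| < 1)}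

variable (G : GaussDiagram)

abbrev Passage : Type := G.Crossing × Bool

variable {G} in
/-- The other passage through the same crossing. -/
def other (p : G.Passage) : G.Passage := (p.1, !p.2)

/-- Whether `p` runs along the horizontal axis of its plaque. Since (horizontal, vertical) is
the positive frame, the horizontal strand of a positive crossing is the over strand, and that of a
negative crossing is the under strand. -/
def horizontal (p : G.Passage) : Bool := p.2 == G.positive p.1

/-- The side of the plaque through which the passage `p` leaves; the parameter `t` is the
coordinate transverse to `p`, positive on the left of `p`. -/
def outSide (p : G.Passage) (t : Set.Ioo (-1 : ℝ) 1) : Plaque :=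
  have h : |(t : ℝ)| < 1 := abs_lt.mpr t.2
  if G.horizontal p then ⟨(1, t), by simp [h, h.le]⟩ else ⟨(-t, 1), by simp [h, h.le]⟩

/-- The side of the plaque through which the passage `p` enters; the parameter `t` is the
coordinate transverse to `p`, positive on the left of `p`. -/
def inSide (p : G.Passage) (t : Set.Ioo (-1 : ℝ) 1) : Plaque :=
  have h : |(t : ℝ)| < 1 := abs_lt.mpr t.2
  if G.horizontal p then ⟨(-1, t), by simp [h, h.le]⟩ else ⟨(-t, -1), by simp [h, h.le]⟩

/-- One plaque for each real crossing and one open annulus for each component without real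
crossings. -/
abbrev Pieces : Type :=
  (Σ _ : G.Crossing, Plaque) ⊕ (Σ _ : G.Loop, UnitAddCircle × Set.Ioo (-1 : ℝ) 1)

/-- For each arc of the link from a passage `p` to the following one, the outgoing end of `p` is
glued to the incoming end of `next p`, left to left and right to right (no twist). -/
inductive Glue : G.Pieces → G.Pieces → Prop
  | arc (p : G.Passage) (t : Set.Ioo (-1 : ℝ) 1) :
      Glue (.inl ⟨p.1, G.outSide p t⟩) (.inl ⟨(G.next p).1, G.inSide (G.next p) t⟩)

/-- The surface of the associated abstract link diagram, without its boundary: the open ribbon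
neighbourhood obtained by joining plaques at the real crossings along the arcs of the link. The
link diagram in it consists of the two axes of each plaque and the core of each annulus. -/
def Surface : Type := Quot G.Glue

instance : TopologicalSpace G.Surface := inferInstanceAs (TopologicalSpace (Quot G.Glue))

end GaussDiagram

/-! ## Poles, pole reductions and the index -/

/-- A sink pole (I-pole) or a source pole (O-pole). -/
inductive PoleKind
  | sink
  | source

/-- A side of a two-sided curve with respect to a direction of travel. -/
inductive Side
  | left
  | right

structure Pole where
  kind : PoleKind
  side : Side

/-- Pole reduction, on the cyclic sequence of the poles of a pole curve: a sink and a source which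
are adjacent on the curve and lie on the same side of it are removed. -/
inductive PoleReduction : Cycle Pole → Cycle Pole → Prop
  | cancel (p q : Pole) (w : List Pole) (hkind : p.kind ≠ q.kind) (hside : p.side = q.side) :
      PoleReduction ((p :: q :: w : List Pole) : Cycle Pole) (w : Cycle Pole)

/-- No pole reduction applies. -/
def PoleIrreducible (w : Cycle Pole) : Prop := ∀ w', ¬ PoleReduction w w'

/-- `k` is half of the number of poles of an irreducible pole curve obtained by pole reductions. -/
def HasIndex (w : Cycle Pole) (k : ℕ) : Prop :=
  ∃ w', Relation.ReflTransGen PoleReduction w w' ∧ PoleIrreducible w' ∧ w'.length = 2 * k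

/-! ## Splices, surface pole states and pole curves -/

inductive Splice
  | A
  | B

namespace GaussDiagram

variable (G : GaussDiagram)

/-- A surface pole state: the choice of a splice at each crossing. -/
abbrev PoleState : Type := G.Crossing → Splice

variable {G}

/-- Whether the splice respects the orientation of the link: the A-splice does so at a positive
crossing and the B-splice at a negative one. The two other splices produce a pair of poles. -/
def PoleState.coherent (s : G.PoleState) (c : G.Crossing) : Bool :=
  match s c with
  | .A => G.positive c
  | .B => !G.positive c

variable (G) in
/-- `(p, true)` is the arc of the link from `p` to `next p` traversed along the orientation of the
link, and `(p, false)` is the same arc traversed backwards. -/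
abbrev Dart : Type := G.Passage × Bool

/-- The passage at whose end a dart arrives: its incoming end for a forward dart, its outgoing end
for a backward one. -/
def arrival : G.Dart → G.Passage
  | (p, true) => G.next p
  | (p, false) => p

/-- The dart which follows a given one on the pole curve. A coherent splice joins the incoming end
of each passage to the outgoing end of the other one; an incoherent splice joins the two incoming
ends and the two outgoing ends. -/
def PoleState.step (s : G.PoleState) (e : G.Dart) : G.Dart :=
  match s.coherent (arrival e).1, e.2 with
  | true, true => (other (arrival e), true)
  | true, false => (G.next.symm (other (arrival e)), false)
  | false, true => (G.next.symm (other (arrival e)), false)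
  | false, false => (other (arrival e), true)

/-- The arc of the pole curve in the plaque at which the dart `e` arrives, from the end where `e`
enters the plaque to the end where `step e` leaves it. It is a segment which joins the midpoints of
two adjacent sides of the square. -/
def PoleState.plaqueArc (s : G.PoleState) (e : G.Dart) : Set Plaque :=
  match s.coherent (arrival e).1, e.2 with
  | true, true =>
      if G.horizontal (arrival e) then {z | z.1.2 - z.1.1 = 1} else {z | z.1.1 - z.1.2 = 1}
  | true, false =>
      if G.horizontal (arrival e) then {z | z.1.1 - z.1.2 = 1} else {z | z.1.2 - z.1.1 = 1}
  | false, true => {z | z.1.1 + z.1.2 = -1}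
  | false, false => {z | z.1.1 + z.1.2 = 1}

/-- The pole on the segment `plaqueArc e`, if any: a sink where the two incoming ends are joined, a
source where the two outgoing ends are joined. It lies on the side of the segment that faces the
crossing point `(0, 0)`; the side is given with respect to the direction of travel. -/
def PoleState.pole? (s : G.PoleState) (e : G.Dart) : Option Pole :=
  match s.coherent (arrival e).1, e.2 with
  | true, _ => none
  | false, true => some ⟨.sink, if G.horizontal (arrival e) then .left else .right⟩
  | false, false => some ⟨.source, if G.horizontal (arrival e) then .left else .right⟩

/-- The pole curves of a state: those that run through a given dart, and the components of the link
without real crossings. (The same curve is listed once for each dart on it, in both directions.) -/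
inductive PoleCurve (s : G.PoleState)
  | through (e : G.Dart)
  | free (i : G.Loop)

/-- The cyclic sequence of the poles on a pole curve, in the order of travel. -/
noncomputable def PoleCurve.poles {s : G.PoleState} : PoleCurve s → Cycle Pole
  | .through e =>
      (((List.range (Function.minimalPeriod s.step e)).filterMap
        fun n => s.pole? (s.step^[n] e) : List Pole) : Cycle Pole)
  | .free _ => Cycle.nil

/-- The underlying simple closed curve of a pole curve. -/
def PoleCurve.carrier {s : G.PoleState} : PoleCurve s → Set G.Surface
  | .through e =>
      ⋃ n : ℕ, (fun z => Quot.mk G.Glue (.inl ⟨(arrival (s.step^[n] e)).1, z⟩)) ''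
        s.plaqueArc (s.step^[n] e)
  | .free i => Set.range fun θ => Quot.mk G.Glue (.inr ⟨i, (θ, ⟨0, by norm_num⟩)⟩)

end GaussDiagram

/-! ## Virtual link diagrams -/

/-- A family of `n` closed curves in the plane, parametrized by `ℝ/ℤ`. -/
abbrev PlaneCurves (n : ℕ) : Type := Fin n → UnitAddCircle → ℂ

namespace PlaneCurves

variable {n : ℕ} (γ : PlaneCurves n)

/-- The image of a point of the parametrizing circles. -/
def image (P : Fin n × UnitAddCircle) : ℂ := γ P.1 P.2

noncomputable def velocity (P : Fin n × UnitAddCircle) : ℂ :=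
  deriv (fun t : ℝ => γ P.1 (P.2 + (t : UnitAddCircle))) 0

/-- The determinant of the velocities at `P` and `Q`. -/
noncomputable def det (P Q : Fin n × UnitAddCircle) : ℝ :=
  (γ.velocity P).re * (γ.velocity Q).im - (γ.velocity P).im * (γ.velocity Q).re

end PlaneCurves

/-- An oriented virtual link diagram: closed curves immersed in the plane with finitely many
multiple points, all of which are transverse double points. The set `real` lists each real crossing
once, as the pair (point on the over strand, point on the under strand); all other double points
are virtual crossings. -/
structure VirtualLinkDiagram where
  numComponents : ℕ
  curve : PlaneCurves numComponents
  smooth : ∀ i, ContDiff ℝ ∞ fun t : ℝ => curve i (t : UnitAddCircle)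
  immersed : ∀ P, curve.velocity P ≠ 0
  finite : {P | ∃ Q, Q ≠ P ∧ curve.image Q = curve.image P}.Finite
  no_triple : ∀ P Q R, curve.image P = curve.image Q → curve.image Q = curve.image R →
    P = Q ∨ Q = R ∨ P = R
  transverse : ∀ P Q, P ≠ Q → curve.image P = curve.image Q → curve.det P Q ≠ 0
  real : Finset ((Fin numComponents × UnitAddCircle) × (Fin numComponents × UnitAddCircle))
  real_double : ∀ c ∈ real, c.1 ≠ c.2 ∧ curve.image c.1 = curve.image c.2
  real_once : ∀ c ∈ real, c.swap ∉ real

namespace VirtualLinkDiagram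

variable (D : VirtualLinkDiagram)

/-- The real crossings. -/
abbrev Crossing : Type := {c // c ∈ D.real}

/-- The point of the parametrizing circles at which a real crossing is passed. -/
def point (p : D.Crossing × Bool) : Fin D.numComponents × UnitAddCircle :=
  if p.2 then p.1.1.1 else p.1.1.2

/-- Moving along the link from `p`, the first passage through a real crossing that is met is
`q` (which is `p` itself if there is no other one on its component). -/
def IsNext (p q : D.Crossing × Bool) : Prop :=
  ∃ τ : ℝ, 0 < τ ∧ D.point q = ((D.point p).1, (D.point p).2 + (τ : UnitAddCircle)) ∧
    ∀ τ' : ℝ, 0 < τ' → τ' < τ →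
      ∀ r, D.point r ≠ ((D.point p).1, (D.point p).2 + (τ' : UnitAddCircle))

theorem point_injective : Function.Injective D.point := by
  rintro ⟨⟨⟨P, Q⟩, hc⟩, b⟩ ⟨⟨⟨P', Q'⟩, hc'⟩, b'⟩ h
  have h1 := D.real_double _ hc
  have h2 := D.real_double _ hc'
  have h3 := D.real_once _ hc
  have key := D.no_triple
  simp only [Prod.swap_prod_mk] at h1 h2 h3
  obtain ⟨n1, e1⟩ := h1
  obtain ⟨n2, e2⟩ := h2
  cases b <;> cases b' <;> simp only [point, if_true, if_false, Bool.false_eq_true] at h <;> subst h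
  · rcases key P Q P' e1 e2.symm with h | h | h
    · exact absurd h n1
    · exact absurd h.symm n2
    · subst h; rfl
  · rcases key P Q Q' e1 e2 with h | h | h
    · exact absurd h n1
    · exact absurd h n2
    · subst h; exact absurd hc' h3
  · rcases key Q P P' e1.symm e2.symm with h | h | h
    · exact absurd h.symm n1
    · exact absurd h.symm n2
    · subst h; exact absurd hc' h3
  · rcases key Q P Q' e1.symm e2 with h | h | h
    · exact absurd h.symm n1
    · exact absurd h n2
    · subst h; rfl

theorem exists_isNext (p : D.Crossing × Bool) : ∃ q, D.IsNext p q := by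
  have hfin : (⋃ r : D.Crossing × Bool, {τ : ℝ | τ ∈ Set.Ioc (0 : ℝ) 1 ∧
      D.point r = ((D.point p).1, (D.point p).2 + (τ : UnitAddCircle))}).Finite := by
    refine Set.finite_iUnion fun r => Set.Subsingleton.finite ?_
    rintro τ ⟨h, hr⟩ τ' ⟨h', hr'⟩
    have e := (Prod.ext_iff.mp (hr.symm.trans hr')).2
    have e2 : (τ : UnitAddCircle) = (τ' : UnitAddCircle) := add_left_cancel e
    exact (AddCircle.coe_eq_coe_iff_of_mem_Ioc (p := (1 : ℝ)) (a := 0)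
      (by simpa using h) (by simpa using h')).mp e2
  have hne : (⋃ r : D.Crossing × Bool, {τ : ℝ | τ ∈ Set.Ioc (0 : ℝ) 1 ∧
      D.point r = ((D.point p).1, (D.point p).2 + (τ : UnitAddCircle))}).Nonempty := by
    refine ⟨1, Set.mem_iUnion.mpr ⟨p, by simp, ?_⟩⟩
    have : ((1 : ℝ) : UnitAddCircle) = 0 := AddCircle.coe_period (1 : ℝ)
    rw [this, add_zero]
  obtain ⟨τ, hτ, hmin⟩ := Set.exists_min_image _ id hfin hne
  obtain ⟨q, hτ1, hq⟩ := Set.mem_iUnion.mp hτ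
  refine ⟨q, τ, hτ1.1, hq, fun τ' h0 hlt r hr => ?_⟩
  exact absurd (hmin τ' (Set.mem_iUnion.mpr ⟨r, ⟨h0, hlt.le.trans hτ1.2⟩, hr⟩)) (not_le.mpr hlt)

theorem IsNext.injective {p p' q : D.Crossing × Bool} (h : D.IsNext p q) (h' : D.IsNext p' q) :
    p = p' := by
  have aux : ∀ {p p' : D.Crossing × Bool} {τ τ' : ℝ}, τ ≤ τ' → 0 < τ →
      D.point q = ((D.point p).1, (D.point p).2 + (τ : UnitAddCircle)) →
      D.point q = ((D.point p').1, (D.point p').2 + (τ' : UnitAddCircle)) →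
      (∀ t : ℝ, 0 < t → t < τ' →
        ∀ r, D.point r ≠ ((D.point p').1, (D.point p').2 + (t : UnitAddCircle))) → p = p' := by
    intro p p' τ τ' hle h0 hq hq' hno
    obtain ⟨e1, e2⟩ := Prod.ext_iff.mp (hq.symm.trans hq')
    have e3 : D.point p = ((D.point p').1, (D.point p').2 + ((τ' - τ : ℝ) : UnitAddCircle)) := by
      refine Prod.ext e1 ?_
      simp only at e2 ⊢
      rw [AddCircle.coe_sub, ← add_sub_assoc, ← e2, add_sub_cancel_right]
    rcases hle.eq_or_lt with rfl | hlt
    · refine D.point_injective (e3.trans ?_)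
      simp
    · exact absurd e3 (hno (τ' - τ) (by linarith) (by linarith) p)
  obtain ⟨τ, h0, hq, hno⟩ := h
  obtain ⟨τ', h0', hq', hno'⟩ := h'
  rcases le_total τ τ' with hle | hle
  · exact aux hle h0 hq hq' hno'
  · exact (aux hle h0' hq' hq hno).symm

/-- The passage that follows a given one along the link. -/
noncomputable def next : Equiv.Perm (D.Crossing × Bool) :=
  Equiv.ofBijective (fun p => (D.exists_isNext p).choose) <|
    Finite.injective_iff_bijective.mp fun p p' h => by
      have h1 := (D.exists_isNext p).choose_spec
      have h2 := (D.exists_isNext p').choose_spec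
      have h3 : (D.exists_isNext p).choose = (D.exists_isNext p').choose := h
      rw [← h3] at h2
      exact IsNext.injective D h1 h2

open Classical in
/-- The Gauss diagram of a virtual link diagram. A real crossing is positive if the frame
(velocity of the over strand, velocity of the under strand) is positive. -/
noncomputable def gaussDiagram : GaussDiagram where
  Crossing := D.Crossing
  next := D.next
  positive c := decide (0 < D.curve.det c.1.1 c.1.2)
  Loop := {i : Fin D.numComponents // ∀ p, (D.point p).1 ≠ i}

/-- A link diagram realization of `D` in `F`: an embedding, as an open subsurface of `F`, of the
surface of the abstract link diagram associated with `D`. The realized diagram is the image of the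
link diagram in that surface. -/
structure Realization (F : Type*) [TopologicalSpace F] where
  toFun : D.gaussDiagram.Surface → F
  isOpenEmbedding : Topology.IsOpenEmbedding toFun

end VirtualLinkDiagram

/-! ## Separating curves -/

/-- A subset `l` of `F` is separating if two points of its complement lie in the same connected
component of `F` but in different connected components of the complement of `l`. For connected `F`
this means that the complement of `l` is disconnected. -/
def IsSeparating {F : Type*} [TopologicalSpace F] (l : Set F) : Prop :=
  ∃ x ∈ lᶜ, ∃ y ∈ lᶜ, connectedComponent x = connectedComponent y ∧
    connectedComponentIn lᶜ x ≠ connectedComponentIn lᶜ y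

/-!
Give a pole the charge ±1 that is the product of a sign for its kind and a sign for its side. A
reduction removes two poles of opposite charges, and all charges of an irreducible word agree since
sinks and sources alternate along a pole curve, so `2 * ι(l)` is the absolute total charge of `l`.

Let `X` be a component of the complement of `l`, and colour each point by whether it lies in `X`.
Count the poles with signs according to kind, weighted by the colour on the side of their arc on
which they lie. At each crossing the count is zero: the two arcs face each other across the centre,
and one carries a sink and the other a source. Along each pole curve, the colour on either side is
constant, and the count without the side is zero since the kinds alternate. A curve other than `l`
has the same colour on both sides and contributes nothing. So if `l` had different colours on its
two sides, its total charge would vanish. Hence for `ι(l) > 0` each component of the complement that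
meets a thin band around `l` contains the band without `l`, and no such `l` separates.
-/

/-! ## Charges of pole words -/

/-- The sign of a kind of pole: `1` for a sink, `-1` for a source. -/
def PoleKind.sign : PoleKind → ℤ
  | .sink => 1
  | .source => -1

/-- The sign of a side: `1` for the left, `-1` for the right. -/
def Side.sign : Side → ℤ
  | .left => 1
  | .right => -1

theorem PoleKind.sign_eq_neg_of_ne {a b : PoleKind} (h : a ≠ b) : a.sign = -b.sign := by
  cases a <;> cases b <;> first | rfl | exact absurd rfl h

theorem Side.sign_eq_neg_of_ne {a b : Side} (h : a ≠ b) : a.sign = -b.sign := by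
  cases a <;> cases b <;> first | rfl | exact absurd rfl h

/-- The charge of a pole, the invariant that pole reductions preserve: the product of the signs of
its kind and of its side. -/
def Pole.charge (p : Pole) : ℤ := p.kind.sign * p.side.sign

theorem Pole.abs_charge (p : Pole) : |p.charge| = 1 := by
  rcases p with ⟨_ | _, _ | _⟩ <;> rfl

/-- The sum of the charges of the poles on a pole curve. -/
def totalCharge (w : Cycle Pole) : ℤ := (w.toMultiset.map Pole.charge).sum

theorem totalCharge_coe (l : List Pole) : totalCharge l = (l.map Pole.charge).sum := by
  simp [totalCharge]

theorem PoleReduction.totalCharge_eq {w w' : Cycle Pole} (h : PoleReduction w w') :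
    totalCharge w = totalCharge w' := by
  obtain ⟨p, q, w, hkind, hside⟩ := h
  simp only [totalCharge_coe, List.map_cons, List.sum_cons, Pole.charge, hside,
    PoleKind.sign_eq_neg_of_ne hkind]
  ring

/-- Sinks and sources alternate on the pole curve. -/
def AlternatingPoles (w : Cycle Pole) : Prop := w.Chain fun p q => p.kind ≠ q.kind

theorem PoleKind.ne_of_ne_of_ne_of_ne {a b c d : PoleKind} (hab : a ≠ b) (hbc : b ≠ c)
    (hcd : c ≠ d) : a ≠ d := by
  cases a <;> cases b <;> cases c <;> cases d <;> simp_all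

theorem PoleReduction.alternatingPoles {w w' : Cycle Pole} (h : PoleReduction w w')
    (hw : AlternatingPoles w) : AlternatingPoles w' := by
  obtain ⟨p, q, w, -, -⟩ := h
  cases w with
  | nil => exact Cycle.Chain.nil _
  | cons r w =>
    simp only [AlternatingPoles, Cycle.chain_coe_cons, List.cons_append,
      List.isChain_cons_cons] at hw ⊢
    obtain ⟨hpq, hqr, hw⟩ := hw
    rw [← List.cons_append, List.isChain_append] at hw ⊢
    exact ⟨hw.1, List.isChain_singleton r, fun x hx y hy => by
      obtain rfl : r = y := by simpa using hy
      exact PoleKind.ne_of_ne_of_ne_of_ne (hw.2.2 x hx p rfl) hpq hqr⟩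

theorem PoleIrreducible.isChain_charge_eq {l : List Pole} (hirr : PoleIrreducible l)
    (halt : l.IsChain fun p q => p.kind ≠ q.kind) : l.IsChain fun p q => p.charge = q.charge := by
  refine List.isChain_iff_forall_rel_of_append_cons_cons.mpr fun p q l₁ l₂ hl => ?_
  have hkind : p.kind ≠ q.kind := List.isChain_iff_forall_rel_of_append_cons_cons.mp halt hl
  have hside : p.side ≠ q.side := fun hside => by
    have hrot : (l : Cycle Pole) = (p :: q :: (l₂ ++ l₁) : List Pole) := by
      rw [hl, Cycle.coe_eq_coe]
      exact List.isRotated_append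
    exact hirr _ (hrot.symm ▸ PoleReduction.cancel p q (l₂ ++ l₁) hkind hside)
  rw [Pole.charge, Pole.charge, PoleKind.sign_eq_neg_of_ne hkind, Side.sign_eq_neg_of_ne hside,
    neg_mul_neg]

theorem PoleIrreducible.abs_totalCharge {w : Cycle Pole} (hirr : PoleIrreducible w)
    (halt : AlternatingPoles w) : |totalCharge w| = w.length := by
  obtain ⟨l, rfl⟩ : ∃ l : List Pole, (l : Cycle Pole) = w := Quot.exists_rep w
  cases l with
  | nil => rfl
  | cons p l =>
    have hkind := ((Cycle.chain_coe_cons _ p l).mp halt).left_of_append (l₁ := p :: l)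
    have heq : ∀ c ∈ (p :: l).map Pole.charge, c = p.charge := by
      have hpair := List.isChain_iff_pairwise.mp
        ((List.isChain_map Pole.charge).mpr (hirr.isChain_charge_eq hkind))
      simpa [eq_comm] using (List.pairwise_cons.mp hpair).1
    rw [totalCharge_coe, List.sum_eq_card_nsmul _ _ heq, abs_nsmul, Pole.abs_charge]
    simp

theorem HasIndex.two_mul_eq_abs_totalCharge {w : Cycle Pole} {k : ℕ} (h : HasIndex w k)
    (hw : AlternatingPoles w) : (2 * k : ℤ) = |totalCharge w| := by
  obtain ⟨w', hred, hirr, hlen⟩ := h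
  induction hred using Relation.ReflTransGen.head_induction_on with
  | refl => rw [hirr.abs_totalCharge hw, hlen, Nat.cast_mul, Nat.cast_two]
  | head hstep _ ih => rw [hstep.totalCharge_eq, ih (hstep.alternatingPoles hw)]

/-! ## Charges along pole curves -/

section PeriodicOrbit

open Function

variable {α : Type*} {f : α → α}

theorem apply_mem_periodicOrbit_iff [Finite α] (hf : Injective f) {x y : α} :
    f y ∈ periodicOrbit f x ↔ y ∈ periodicOrbit f x := by
  rw [mem_periodicOrbit_iff (hf.mem_periodicPts x), mem_periodicOrbit_iff (hf.mem_periodicPts x)]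
  constructor
  · rintro ⟨n, hn⟩
    obtain ⟨m, hm, hy⟩ := hf.mem_periodicPts y
    obtain ⟨m, rfl⟩ := Nat.exists_eq_add_one.mpr hm
    exact ⟨m + n, by rw [iterate_add_apply, hn, ← iterate_succ_apply]; exact hy⟩
  · rintro ⟨n, rfl⟩
    exact ⟨n + 1, iterate_succ_apply' f n x⟩

theorem sum_mem_periodicOrbit [Fintype α] {M : Type*} [AddCommMonoid M] (f : α → α) (x : α)
    [DecidablePred (· ∈ periodicOrbit f x)] (g : α → M) :
    ∑ y with y ∈ periodicOrbit f x, g y = ∑ n ∈ Finset.range (minimalPeriod f x), g (f^[n] x) := by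
  have hmem (y) : y ∈ periodicOrbit f x ↔ ∃ n < minimalPeriod f x, f^[n] x = y := by
    simp [periodicOrbit, eq_comm]
  refine (Finset.sum_nbij (fun n => f^[n] x) (fun n hn => ?_) (fun m hm n hn h => ?_)
    (fun y hy => ?_) fun _ _ => rfl).symm
  · exact Finset.mem_filter_univ _ |>.mpr ((hmem _).mpr ⟨n, Finset.mem_range.mp hn, rfl⟩)
  · exact iterate_injOn_Iio_minimalPeriod (Finset.mem_range.mp hm) (Finset.mem_range.mp hn) h
  · obtain ⟨n, hn, rfl⟩ := (hmem y).mp (Finset.mem_filter_univ _ |>.mp hy)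
    exact ⟨n, Finset.mem_coe.mpr (Finset.mem_range.mpr hn), rfl⟩

end PeriodicOrbit

theorem sum_map_filterMap {α β M : Type*} [AddMonoid M] (g : α → Option β) (f : β → M)
    (l : List α) : ((l.filterMap g).map f).sum = (l.map fun a => (g a).elim 0 f).sum := by
  induction l with
  | nil => rfl
  | cons a l ih => cases h : g a <;> simp [h, ih]

namespace GaussDiagram

variable {G : GaussDiagram}

/-- The same arc of the link, traversed in the opposite direction. -/
def Dart.rev (e : G.Dart) : G.Dart := (e.1, !e.2)

theorem Dart.rev_rev (e : G.Dart) : e.rev.rev = e := by simp [rev]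

theorem Dart.eq_of_arrival_eq {e e' : G.Dart} (h : arrival e = arrival e') (h' : e.2 = e'.2) :
    e = e' := by
  rcases e with ⟨p, _ | _⟩ <;> rcases e' with ⟨p', _ | _⟩ <;> simp_all [arrival]

theorem other_other (p : G.Passage) : other (other p) = p := by simp [other]

theorem horizontal_other (p : G.Passage) : G.horizontal (other p) = !G.horizontal p := by
  rcases p with ⟨c, _ | _⟩ <;> cases h : G.positive c <;> simp [horizontal, other, h]

theorem eq_or_eq_other_of_fst_eq {p q : G.Passage} (h : p.1 = q.1) : p = q ∨ p = other q := by
  rcases p with ⟨c, _ | _⟩ <;> rcases q with ⟨d, _ | _⟩ <;> simp_all [other]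

/-- The kind of the pole that a dart meets at a crossing whose splice is not coherent. -/
def Dart.poleKind (e : G.Dart) : PoleKind := if e.2 then .sink else .source

theorem Dart.poleKind_ne_iff {e e' : G.Dart} : e.poleKind ≠ e'.poleKind ↔ e.2 = !e'.2 := by
  rcases e with ⟨p, _ | _⟩ <;> rcases e' with ⟨p', _ | _⟩ <;> simp [poleKind]

namespace PoleState

variable (s : G.PoleState)

/-- The dart whose arc in its plaque is that of `e` traversed backwards. -/
def flip (e : G.Dart) : G.Dart := (s.step e).rev

/-- The darts on the pole curve through `e`. -/
def orbit (e : G.Dart) : Set G.Dart := {e' | e' ∈ Function.periodicOrbit s.step e}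

/-- The sign of the kind of the pole on `plaqueArc e`, or `0` if there is no pole. -/
def poleSign (e : G.Dart) : ℤ := (s.pole? e).elim 0 fun p => p.kind.sign

/-- The charge of the pole on `plaqueArc e`, or `0` if there is no pole. -/
def charge (e : G.Dart) : ℤ := (s.pole? e).elim 0 Pole.charge

variable {s} {e : G.Dart}

theorem arrival_flip : arrival (s.flip e) = other (arrival e) := by
  rcases e with ⟨p, _ | _⟩ <;> simp only [flip, step, Dart.rev] <;>
    split <;> simp_all [arrival]

theorem arrival_flip_fst : (arrival (s.flip e)).1 = (arrival e).1 := by rw [arrival_flip, other]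

theorem horizontal_arrival_flip :
    G.horizontal (arrival (s.flip e)) = !G.horizontal (arrival e) := by
  rw [arrival_flip, horizontal_other]

theorem step_snd : (s.step e).2 = (e.2 == s.coherent (arrival e).1) := by
  simp only [step]
  split <;> simp_all

theorem flip_snd : (s.flip e).2 = (e.2 ^^ s.coherent (arrival e).1) := by
  simp only [flip, Dart.rev, step_snd]
  rfl

theorem flip_flip : s.flip (s.flip e) = e :=
  Dart.eq_of_arrival_eq (by rw [arrival_flip, arrival_flip, other_other]) (by
    rw [flip_snd, flip_snd, arrival_flip_fst, Bool.xor_assoc, Bool.xor_self, Bool.xor_false])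

theorem rev_flip : (s.flip e).rev = s.step e := Dart.rev_rev _

theorem step_flip : s.step (s.flip e) = e.rev := by rw [← rev_flip, flip_flip]

theorem flip_involutive : Function.Involutive s.flip := fun _ => flip_flip

theorem step_injective : Function.Injective s.step :=
  Function.LeftInverse.injective (g := fun e => s.flip e.rev) fun _ => flip_flip

theorem mem_orbit_iff {e' : G.Dart} : e' ∈ s.orbit e ↔ ∃ n, s.step^[n] e = e' :=
  Function.mem_periodicOrbit_iff (s.step_injective.mem_periodicPts e)

theorem step_mem_orbit_iff {e' : G.Dart} : s.step e' ∈ s.orbit e ↔ e' ∈ s.orbit e :=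
  apply_mem_periodicOrbit_iff step_injective

theorem eq_of_mem_orbit {α : Type*} {φ : G.Dart → α} (hφ : ∀ e, φ (s.step e) = φ e) {e' : G.Dart}
    (he : e' ∈ s.orbit e) : φ e' = φ e := by
  obtain ⟨n, rfl⟩ := mem_orbit_iff.mp he
  exact Function.Iterate.rec (fun e' => φ e' = φ e) rfl (fun e' he => (hφ e').trans he) n

theorem flip_rev_mem_orbit_iff {e' : G.Dart} : s.flip e'.rev ∈ s.orbit e ↔ e' ∈ s.orbit e := by
  rw [← step_mem_orbit_iff, step_flip, Dart.rev_rev]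

theorem pole?_eq_none (h : s.coherent (arrival e).1 = true) : s.pole? e = none := by
  simp only [pole?, h]

theorem pole?_eq_some (h : s.coherent (arrival e).1 = false) :
    s.pole? e = some ⟨e.poleKind, if G.horizontal (arrival e) then .left else .right⟩ := by
  rcases he : e.2 <;> simp [pole?, h, he, Dart.poleKind]

theorem kind_eq_of_pole?_eq_some {p : Pole} (h : s.pole? e = some p) : p.kind = e.poleKind := by
  cases hc : s.coherent (arrival e).1
  · rw [pole?_eq_some hc, Option.some.injEq] at h
    rw [← h]
  · simp [pole?_eq_none hc] at h

theorem poleKind_step_of_pole?_eq_none (h : s.pole? e = none) :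
    (s.step e).poleKind = e.poleKind := by
  cases hc : s.coherent (arrival e).1
  · simp [pole?_eq_some hc] at h
  · simp [Dart.poleKind, step_snd, hc]

theorem poleKind_ne_poleKind_step {p : Pole} (h : s.pole? e = some p) :
    e.poleKind ≠ (s.step e).poleKind := by
  cases hc : s.coherent (arrival e).1
  · simp [Dart.poleKind_ne_iff, step_snd, hc]
  · simp [pole?_eq_none hc] at h

theorem two_mul_poleSign : 2 * s.poleSign e = e.poleKind.sign - (s.step e).poleKind.sign := by
  cases h : s.pole? e with
  | none => simp [poleSign, h, poleKind_step_of_pole?_eq_none h]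
  | some p =>
    rw [PoleKind.sign_eq_neg_of_ne (poleKind_ne_poleKind_step h).symm, poleSign, h,
      Option.elim_some, kind_eq_of_pole?_eq_some h]
    ring

theorem poleSign_eq :
    s.poleSign e = (if s.coherent (arrival e).1 then 0 else 1) * e.poleKind.sign := by
  cases h : s.coherent (arrival e).1
  · simp [poleSign, pole?_eq_some h]
  · simp [poleSign, pole?_eq_none h]

theorem charge_flip : s.charge (s.flip e) = -s.charge e := by
  cases h : s.coherent (arrival e).1
  · have h' : s.coherent (arrival (s.flip e)).1 = false := by rwa [arrival_flip_fst]
    have hk : (s.flip e).poleKind = e.poleKind := by simp [Dart.poleKind, flip_snd, h]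
    cases hh : G.horizontal (arrival e) <;>
      simp [charge, pole?_eq_some h, pole?_eq_some h', hk, horizontal_arrival_flip, hh,
        Pole.charge, Side.sign]
  · have h' : s.coherent (arrival (s.flip e)).1 = true := by rwa [arrival_flip_fst]
    simp [charge, pole?_eq_none, h, h']

variable {φ : G.Dart → ℤ} {ψ : G.Crossing → ℤ}

theorem sum_mul_poleSign_of_step_invariant (hφ : ∀ e, φ (s.step e) = φ e) :
    ∑ e, φ e * s.poleSign e = 0 := by
  have hstep : ∑ e, φ e * (s.step e).poleKind.sign = ∑ e, φ e * e.poleKind.sign := by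
    simpa only [hφ] using (Finite.injective_iff_bijective.mp s.step_injective).sum_comp
      fun e : G.Dart => φ e * e.poleKind.sign
  have hdouble : 2 * ∑ e, φ e * s.poleSign e = 0 := by
    simp only [Finset.mul_sum, mul_left_comm, two_mul_poleSign, mul_sub, Finset.sum_sub_distrib,
      hstep, sub_self]
  simpa using hdouble

theorem sum_mul_poleSign_of_arrival (ψ : G.Crossing → ℤ) :
    ∑ e, ψ (arrival e).1 * s.poleSign e = 0 := by
  have hnext := Equiv.sum_comp G.next fun p => ψ p.1 * if s.coherent p.1 then 0 else 1
  simp only [poleSign_eq, ← mul_assoc]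
  rw [Fintype.sum_prod_type]
  simp only [arrival, Dart.poleKind, PoleKind.sign, Fintype.sum_bool, Finset.sum_add_distrib,
    if_true, Bool.false_eq_true, if_false, mul_one, mul_neg, Finset.sum_neg_distrib]
  exact add_neg_eq_zero.mpr hnext

theorem sum_mul_charge_flip (φ : G.Dart → ℤ) :
    ∑ e, φ (s.flip e) * s.charge e = -∑ e, φ e * s.charge e := by
  have h := s.flip_involutive.bijective.sum_comp fun e => φ e * s.charge e
  simp only [charge_flip, mul_neg, Finset.sum_neg_distrib] at h
  rw [← h, neg_neg]

theorem sum_mul_charge_of_arrival (ψ : G.Crossing → ℤ) :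
    ∑ e, ψ (arrival e).1 * s.charge e = 0 := by
  have h := s.sum_mul_charge_flip fun e => ψ (arrival e).1
  simp only [arrival_flip_fst] at h
  exact self_eq_neg.mp h

-- At a pole on the left `φ` agrees with `ψ` and at a pole on the right the charge is minus the
-- sign of the kind, so in both cases `φ * (charge + sign) = ψ * (charge + sign)`.
theorem sum_mul_charge_of_left_pole (hφ : ∀ e, φ (s.step e) = φ e)
    (hψ : ∀ e p, s.pole? e = some p → p.side = .left → φ e = ψ (arrival e).1) :
    ∑ e, φ e * s.charge e = 0 := by
  have hlocal : ∀ e, φ e * s.charge e =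
      ψ (arrival e).1 * s.charge e + ψ (arrival e).1 * s.poleSign e - φ e * s.poleSign e := by
    intro e
    cases h : s.pole? e with
    | none => simp [charge, poleSign, h]
    | some p =>
      cases hp : p.side
      · rw [hψ e p h hp]
        ring
      · simp [charge, poleSign, h, Pole.charge, hp, Side.sign]
  simp_rw [hlocal, Finset.sum_sub_distrib, Finset.sum_add_distrib]
  rw [sum_mul_charge_of_arrival, sum_mul_poleSign_of_arrival,
    sum_mul_poleSign_of_step_invariant hφ, add_zero, sub_zero]

section

variable {e₀ : G.Dart} [DecidablePred (· ∈ s.orbit e₀)]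

theorem sum_mul_charge_of_flip_odd (hstep : ∀ e, φ (s.step e) = φ e)
    (hflip : ∀ e, φ (s.flip e) = -φ e)
    (hoff : ∀ e, e ∉ s.orbit e₀ → s.flip e ∉ s.orbit e₀ → φ e = 0) :
    ∑ e, φ e * s.charge e = 2 * φ e₀ * ∑ e with e ∈ s.orbit e₀, s.charge e := by
  have horbit : ∀ e ∈ s.orbit e₀, φ e = φ e₀ := fun e he => eq_of_mem_orbit hstep he
  have hlocal (e) : φ e * s.charge e =
      φ e₀ * ((if e ∈ s.orbit e₀ then s.charge e else 0) +
        if s.flip e ∈ s.orbit e₀ then s.charge (s.flip e) else 0) := by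
    by_cases he : e ∈ s.orbit e₀ <;>
      by_cases he' : s.flip e ∈ s.orbit e₀
    · have hzero : φ e = 0 := self_eq_neg.mp <| by
        rw [← hflip, horbit e he, horbit _ he']
      simp [hzero, ← horbit e he]
    · simp [he, he', horbit e he]
    · simp [he, he', charge_flip, ← horbit _ he', hflip]
    · simp [he, he', hoff e he he']
  have hsum_flip := s.flip_involutive.bijective.sum_comp
    fun e => if e ∈ s.orbit e₀ then s.charge e else 0
  simp only [hlocal, ← Finset.mul_sum, Finset.sum_add_distrib, hsum_flip, ← Finset.sum_filter]
  ring

theorem sum_charge_orbit_eq_zero (hφ : ∀ e, φ (s.step e) = φ e)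
    (hψ : ∀ e p, s.pole? e = some p → p.side = .left → φ e = ψ (arrival e).1)
    (hoff : ∀ e, e ∉ s.orbit e₀ → s.flip e ∉ s.orbit e₀ → φ e.rev = φ e)
    (hne : φ e₀.rev ≠ φ e₀) :
    ∑ e with e ∈ s.orbit e₀, s.charge e = 0 := by
  have hflip (e) : φ (s.flip e) = φ e.rev := by rw [← hφ, step_flip]
  have hjump := sum_mul_charge_of_flip_odd (e₀ := e₀) (φ := fun e => φ e - φ (s.flip e))
    (fun e => by rw [hφ, hflip, ← flip]) (fun e => by rw [flip_flip, neg_sub])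
    fun e he he' => by rw [hflip, hoff e he he', sub_self]
  simp only [sub_mul, Finset.sum_sub_distrib, sum_mul_charge_flip,
    sum_mul_charge_of_left_pole hφ hψ, neg_zero, sub_zero] at hjump
  have hne' : 2 * (φ e₀ - φ (s.flip e₀)) ≠ 0 :=
    mul_ne_zero two_ne_zero (sub_ne_zero.mpr (hflip e₀ ▸ hne.symm))
  exact (mul_eq_zero.mp hjump.symm).resolve_left hne'

end

theorem exists_map_kind_append_eq_cons (s : G.PoleState) (n : ℕ) (e : G.Dart) :
    ∃ l, ((List.iterate s.step e n).filterMap s.pole?).map Pole.kind ++ [(s.step^[n] e).poleKind] =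
      e.poleKind :: l ∧ (e.poleKind :: l).IsChain (· ≠ ·) := by
  induction n generalizing e with
  | zero => exact ⟨[], rfl, List.isChain_singleton _⟩
  | succ n ih =>
    obtain ⟨l, hl, hchain⟩ := ih (s.step e)
    cases h : s.pole? e with
    | none =>
      rw [poleKind_step_of_pole?_eq_none h] at hl hchain
      exact ⟨l, by simpa [List.iterate, h] using hl, hchain⟩
    | some p =>
      exact ⟨_, by simp [List.iterate, h, hl, kind_eq_of_pole?_eq_some h],
        List.isChain_cons_cons.mpr ⟨poleKind_ne_poleKind_step h, hchain⟩⟩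

end PoleState

variable {s : G.PoleState}

theorem PoleCurve.poles_through (e : G.Dart) :
    (PoleCurve.through (s := s) e).poles =
      ((List.iterate s.step e (Function.minimalPeriod s.step e)).filterMap s.pole? :
        List Pole) := by
  rw [poles, ← List.range_map_iterate, List.filterMap_map]
  rfl

theorem PoleCurve.alternatingPoles (l : PoleCurve s) : AlternatingPoles l.poles := by
  cases l with
  | free i => exact Cycle.Chain.nil _
  | through e =>
    obtain ⟨l, hl, hchain⟩ := s.exists_map_kind_append_eq_cons (Function.minimalPeriod s.step e) e
    rw [Function.iterate_minimalPeriod] at hl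
    rw [poles_through]
    generalize (List.iterate _ _ _).filterMap s.pole? = w at hl
    cases w with
    | nil => exact Cycle.Chain.nil _
    | cons p w =>
      rw [List.map_cons, List.cons_append, List.cons_eq_cons] at hl
      rw [← hl.1, ← hl.2, ← hl.1, ← List.map_singleton (f := Pole.kind), ← List.map_append,
        ← List.map_cons] at hchain
      exact (List.isChain_map _).mp hchain

theorem PoleCurve.totalCharge_poles_through (e : G.Dart) [DecidablePred (· ∈ s.orbit e)] :
    totalCharge (PoleCurve.through (s := s) e).poles =
      ∑ e' with e' ∈ s.orbit e, s.charge e' := by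
  rw [poles_through, totalCharge_coe, sum_map_filterMap, ← List.range_map_iterate, List.map_map]
  have : DecidablePred (· ∈ Function.periodicOrbit s.step e) :=
    inferInstanceAs (DecidablePred (· ∈ s.orbit e))
  convert (sum_mem_periodicOrbit s.step e s.charge).symm <;> rfl

end GaussDiagram

/-! ## Pole curves in the plaques -/

namespace GaussDiagram

variable {G : GaussDiagram}

/-- The coordinate of the plaque in the direction of travel of `e`. -/
noncomputable def Dart.along (e : G.Dart) : ℝ × ℝ →ₗ[ℝ] ℝ :=
  let x := if G.horizontal (arrival e) then .fst ℝ ℝ ℝ else .snd ℝ ℝ ℝ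
  if e.2 then x else -x

/-- The coordinate of the plaque transverse to `e`, positive on the left. -/
noncomputable def Dart.across (e : G.Dart) : ℝ × ℝ →ₗ[ℝ] ℝ :=
  let y := if G.horizontal (arrival e) then .snd ℝ ℝ ℝ else -.fst ℝ ℝ ℝ
  if e.2 then y else -y

/-- The end of the plaque through which `e` enters; the parameter is positive on the left. -/
def Dart.entry (e : G.Dart) (t : Set.Ioo (-1 : ℝ) 1) : Plaque :=
  if e.2 then G.inSide (arrival e) t
  else G.outSide (arrival e) ⟨-t, neg_lt_neg t.2.2, neg_lt.mp t.2.1⟩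

namespace PoleState

variable (s : G.PoleState) {e e' : G.Dart}

/-- `1` if the pole curve turns left in the plaque at which `e` arrives, `-1` if it turns right. -/
def turn (e : G.Dart) : ℝ := if s.coherent (arrival e).1 == G.horizontal (arrival e) then 1 else -1

/-- The affine function that vanishes on `plaqueArc e` and is positive on its left. -/
noncomputable def height (e : G.Dart) (z : ℝ × ℝ) : ℝ :=
  (e.across - s.turn e • e.along) z - s.turn e

variable {s}

theorem turn_eq_one_or : s.turn e = 1 ∨ s.turn e = -1 := by
  unfold turn; split <;> simp

theorem height_zero : s.height e 0 = -s.turn e := by simp [height]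

theorem height_center_of_pole {p : Pole} (h : s.pole? e = some p) :
    s.height e 0 = p.side.sign := by
  cases hc : s.coherent (arrival e).1
  · rw [pole?_eq_some hc, Option.some.injEq] at h
    cases hh : G.horizontal (arrival e) <;>
      simp [height_zero, turn, hc, hh, ← h, Side.sign]
  · simp [pole?_eq_none hc] at h

theorem height_entry (t : Set.Ioo (-1 : ℝ) 1) : s.height e (e.entry t) = t := by
  rcases hb : e.2 <;> cases hh : G.horizontal (arrival e) <;>
    simp [height, Dart.entry, Dart.along, Dart.across, outSide, inSide, hb, hh]

theorem mem_plaqueArc_iff {z : Plaque} : z ∈ s.plaqueArc e ↔ s.height e z = 0 := by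
  cases hc : s.coherent (arrival e).1 <;> cases hb : e.2 <;>
    cases hh : G.horizontal (arrival e) <;>
    simp [height, turn, plaqueArc, Dart.along, Dart.across, hc, hb, hh] <;> grind

theorem turn_mul_self : s.turn e * s.turn e = 1 := by
  rcases s.turn_eq_one_or (e := e) with h | h <;> simp [h]

theorem turn_flip : s.turn (s.flip e) = -s.turn e := by
  cases hc : s.coherent (arrival e).1 <;> cases hh : G.horizontal (arrival e) <;>
    simp [turn, arrival_flip_fst, horizontal_arrival_flip, hc, hh]

theorem along_flip (z : ℝ × ℝ) : (s.flip e).along z = -(s.turn e * e.across z) := by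
  cases hc : s.coherent (arrival e).1 <;> cases hb : e.2 <;>
    cases hh : G.horizontal (arrival e) <;>
    simp [turn, Dart.along, Dart.across, hc, hb, hh, flip_snd,
      horizontal_arrival_flip]

theorem across_flip (z : ℝ × ℝ) : (s.flip e).across z = s.turn e * e.along z := by
  cases hc : s.coherent (arrival e).1 <;> cases hb : e.2 <;>
    cases hh : G.horizontal (arrival e) <;>
    simp [turn, Dart.along, Dart.across, hc, hb, hh, flip_snd,
      horizontal_arrival_flip]

theorem height_flip (z : ℝ × ℝ) : s.height (s.flip e) z = -s.height e z := by
  simp only [height, turn_flip, along_flip, across_flip, LinearMap.sub_apply,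
    LinearMap.smul_apply, smul_eq_mul]
  linear_combination -e.across z * s.turn_mul_self (e := e)

theorem height_add_height (harr : arrival e' = arrival e) (hne : e' ≠ e) (z : ℝ × ℝ) :
    s.height e' z + s.height e z = -2 * s.turn e := by
  have hb : e'.2 = !e.2 := Bool.eq_not_of_ne fun hb => hne (Dart.eq_of_arrival_eq harr hb)
  have halong : e'.along = -e.along := by
    cases h : e.2 <;> simp [Dart.along, harr, hb, h]
  have hacross : e'.across = -e.across := by
    cases h : e.2 <;> simp [Dart.across, harr, hb, h]
  have hturn : s.turn e' = s.turn e := by rw [turn, turn, harr]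
  simp only [height, halong, hacross, hturn, LinearMap.sub_apply, LinearMap.smul_apply,
    LinearMap.neg_apply, smul_eq_mul]
  ring

theorem eq_of_abs_height_add_abs_height_lt {z : ℝ × ℝ} (harr : arrival e' = arrival e)
    (hz : |s.height e' z| + |s.height e z| < 2) : e' = e := by
  by_contra hne
  have habs : |-2 * s.turn e| = 2 := by
    rcases s.turn_eq_one_or (e := e) with h | h <;> simp [h]
  rw [← habs, ← s.height_add_height harr hne z] at hz
  exact hz.not_ge (abs_add_le _ _)

theorem eq_or_eq_flip_of_abs_height_add_abs_height_lt {z : ℝ × ℝ}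
    (harr : (arrival e').1 = (arrival e).1) (hz : |s.height e' z| + |s.height e z| < 2) :
    e' = e ∨ e' = s.flip e :=
  (eq_or_eq_other_of_fst_eq harr).imp (fun h => eq_of_abs_height_add_abs_height_lt h hz)
    fun h => eq_of_abs_height_add_abs_height_lt (h.trans arrival_flip.symm) (by
      rwa [height_flip, abs_neg])

end PoleState
end GaussDiagram

/-! ## Bands around pole curves -/

namespace GaussDiagram

theorem convex_plaque :
    Convex ℝ {z : ℝ × ℝ | |z.1| ≤ 1 ∧ |z.2| ≤ 1 ∧ (|z.1| < 1 ∨ |z.2| < 1)} := by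
  have hfst : ConvexOn ℝ Set.univ fun z : ℝ × ℝ => |z.1| :=
    convexOn_univ_norm.comp_linearMap (LinearMap.fst ℝ ℝ ℝ)
  have hsnd : ConvexOn ℝ Set.univ fun z : ℝ × ℝ => |z.2| :=
    convexOn_univ_norm.comp_linearMap (LinearMap.snd ℝ ℝ ℝ)
  convert ((hfst.convex_le 1).inter (hsnd.convex_le 1)).inter ((hfst.add hsnd).convex_lt 2) using 1
  ext z
  simp only [Set.mem_ofPred_eq, Set.mem_inter_iff, Set.mem_univ, true_and, Pi.add_apply, and_assoc]
  refine and_congr_right fun h₁ => and_congr_right fun h₂ => ⟨?_, fun h => ?_⟩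
  · rintro (h | h) <;> linarith
  · by_contra! h'
    linarith

variable {G : GaussDiagram}

/-- The quotient map that glues the plaques and annuli. -/
def toSurface (a : G.Pieces) : G.Surface := Quot.mk G.Glue a

theorem isQuotientMap_toSurface : Topology.IsQuotientMap (toSurface (G := G)) :=
  isQuotientMap_quot_mk

theorem toSurface_mem_image_iff {S : Set G.Pieces} (hS : ∀ a b, G.Glue a b → (a ∈ S ↔ b ∈ S))
    {a : G.Pieces} : toSurface a ∈ toSurface '' S ↔ a ∈ S := by
  refine ⟨?_, Set.mem_image_of_mem _⟩
  rintro ⟨b, hb, h⟩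
  exact (congrArg (Quot.lift (· ∈ S) fun a b h => propext (hS a b h)) h).mp hb

/-- The point of the surface with coordinates `z` in the plaque of the crossing `c`. -/
def plaquePoint (c : G.Crossing) (z : Plaque) : G.Surface := toSurface (.inl ⟨c, z⟩)

theorem continuous_plaquePoint (c : G.Crossing) : Continuous (plaquePoint c) :=
  isQuotientMap_toSurface.continuous.comp (continuous_inl.comp continuous_sigmaMk)

theorem Glue.exists_dart {a b : G.Pieces} (h : G.Glue a b) :
    ∃ (e : G.Dart) (t t' : Set.Ioo (-1 : ℝ) 1), (t' : ℝ) = -t ∧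
      a = .inl ⟨(arrival e).1, e.entry t⟩ ∧ b = .inl ⟨(arrival e.rev).1, e.rev.entry t'⟩ := by
  obtain ⟨p, t⟩ := h
  exact ⟨(p, false), ⟨-t, neg_lt_neg t.2.2, neg_lt.mp t.2.1⟩, t, by simp, by
    simp [Dart.entry, arrival], by simp [Dart.entry, arrival, Dart.rev]⟩

theorem plaquePoint_inSide_next (p : G.Passage) (t : Set.Ioo (-1 : ℝ) 1) :
    plaquePoint (G.next p).1 (G.inSide (G.next p) t) = plaquePoint p.1 (G.outSide p t) :=
  (Quot.sound (Glue.arc p t)).symm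

theorem plaquePoint_entry_rev (e : G.Dart) {t t' : Set.Ioo (-1 : ℝ) 1} (h : (t' : ℝ) = -t) :
    plaquePoint (arrival e.rev).1 (e.rev.entry t') = plaquePoint (arrival e).1 (e.entry t) := by
  obtain ⟨t, ht⟩ := t
  obtain ⟨t', ht'⟩ := t'
  obtain rfl : t' = -t := h
  rcases e with ⟨p, _ | _⟩
  · simpa [Dart.entry, arrival, Dart.rev] using plaquePoint_inSide_next p ⟨-t, ht'⟩
  · simpa [Dart.entry, arrival, Dart.rev] using (plaquePoint_inSide_next p ⟨t, ht⟩).symm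

namespace PoleState

variable {s : G.PoleState} {e e₀ : G.Dart}

theorem continuous_height : Continuous (s.height e) :=
  (LinearMap.continuous_of_finiteDimensional _).sub continuous_const

theorem convex_height_preimage_Ioo (u v : ℝ) : Convex ℝ (s.height e ⁻¹' Set.Ioo u v) := by
  have hlinear : s.height e ⁻¹' Set.Ioo u v =
      (e.across - s.turn e • e.along) ⁻¹' Set.Ioo (u + s.turn e) (v + s.turn e) := by
    ext z
    simp only [Set.mem_preimage, Set.mem_Ioo, height, lt_sub_iff_add_lt, sub_lt_iff_lt_add]
  rw [hlinear]
  exact (convex_Ioo _ _).linear_preimage _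

theorem isPreconnected_height_Ioo (u v : ℝ) :
    IsPreconnected {z : Plaque | s.height e z ∈ Set.Ioo u v} := by
  have himage : Subtype.val '' {z : Plaque | s.height e z ∈ Set.Ioo u v} =
      {z | |z.1| ≤ 1 ∧ |z.2| ≤ 1 ∧ (|z.1| < 1 ∨ |z.2| < 1)} ∩ s.height e ⁻¹' Set.Ioo u v :=
    Set.ext fun z => ⟨by rintro ⟨z, hz, rfl⟩; exact ⟨z.2, hz⟩, fun h => ⟨⟨z, h.1⟩, h.2, rfl⟩⟩
  have hconvex := convex_plaque.inter (s.convex_height_preimage_Ioo (e := e) u v)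
  exact Topology.IsInducing.subtypeVal.isPreconnected_image.mp (himage ▸ hconvex.isPreconnected)

theorem abs_lt_one_or_of_height_eq_zero {z : ℝ × ℝ} (h : s.height e z = 0) (h₁ : |z.1| ≤ 1)
    (h₂ : |z.2| ≤ 1) : |z.1| < 1 ∨ |z.2| < 1 := by
  by_contra! hcorner
  have h₁' : z.1 = 1 ∨ z.1 = -1 := eq_or_eq_neg_of_abs_eq (h₁.antisymm hcorner.1)
  have h₂' : z.2 = 1 ∨ z.2 = -1 := eq_or_eq_neg_of_abs_eq (h₂.antisymm hcorner.2)
  rcases h₁' with h₁' | h₁' <;> rcases h₂' with h₂' | h₂' <;> cases hb : e.2 <;>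
    cases hh : G.horizontal (arrival e) <;>
    rcases s.turn_eq_one_or (e := e) with ht | ht <;>
    norm_num [height, Dart.along, Dart.across, hb, hh, ht, h₁', h₂'] at h

theorem isCompact_height_eq_zero : IsCompact {z : Plaque | s.height e z = 0} := by
  have himage : Subtype.val '' {z : Plaque | s.height e z = 0} =
      Set.Icc (-1) 1 ∩ s.height e ⁻¹' {0} := by
    ext z
    constructor
    · rintro ⟨⟨z, h₁, h₂, h⟩, hz, rfl⟩
      exact ⟨⟨⟨neg_le_of_abs_le h₁, neg_le_of_abs_le h₂⟩, le_of_abs_le h₁, le_of_abs_le h₂⟩, hz⟩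
    · rintro ⟨⟨⟨hl₁, hl₂⟩, hu₁, hu₂⟩, hz⟩
      have h₁ : |z.1| ≤ 1 := abs_le.mpr ⟨hl₁, hu₁⟩
      have h₂ : |z.2| ≤ 1 := abs_le.mpr ⟨hl₂, hu₂⟩
      exact ⟨⟨z, h₁, h₂, abs_lt_one_or_of_height_eq_zero hz h₁ h₂⟩, hz, rfl⟩
  rw [Subtype.isCompact_iff, himage]
  exact isCompact_Icc.inter_right (isClosed_singleton.preimage continuous_height)

variable (s) in
/-- The points of the plaques at a height in `A` along the pole curve through `e₀`: the curve itself
for `A = {0}`, a tubular neighbourhood of it for a neighbourhood `A` of `0`. -/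
def band (e₀ : G.Dart) (A : Set ℝ) : Set G.Pieces :=
  ⋃ e ∈ s.orbit e₀, (fun z => .inl ⟨(arrival e).1, z⟩) '' {z : Plaque | s.height e z ∈ A}

variable {A B : Set ℝ}

theorem band_mono (h : A ⊆ B) : s.band e₀ A ⊆ s.band e₀ B :=
  Set.iUnion₂_mono fun _ _ => Set.image_mono fun _ hz => h hz

theorem inl_mem_band_iff {c : G.Crossing} {z : Plaque} :
    .inl ⟨c, z⟩ ∈ s.band e₀ A ↔ ∃ e ∈ s.orbit e₀, (arrival e).1 = c ∧ s.height e z ∈ A := by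
  simp only [band, Set.mem_iUnion, exists_prop]
  refine exists_congr fun e => and_congr_right fun _ => ?_
  constructor
  · rintro ⟨z, hz, h⟩
    obtain ⟨rfl, rfl⟩ : (arrival e).1 = c ∧ z = _ := by simpa using h
    exact ⟨rfl, hz⟩
  · rintro ⟨rfl, hz⟩
    exact ⟨z, hz, rfl⟩

theorem inl_mem_band_iff_of_abs_add_abs_height_lt {z : Plaque}
    (hA : ∀ a ∈ A, |a| + |s.height e z| < 2) :
    .inl ⟨(arrival e).1, z⟩ ∈ s.band e₀ A ↔ e ∈ s.orbit e₀ ∧ s.height e z ∈ A ∨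
      s.flip e ∈ s.orbit e₀ ∧ -s.height e z ∈ A := by
  rw [inl_mem_band_iff]
  constructor
  · rintro ⟨e', he', harr, hz⟩
    rcases eq_or_eq_flip_of_abs_height_add_abs_height_lt harr (hA _ hz) with rfl | rfl
    · exact .inl ⟨he', hz⟩
    · exact .inr ⟨he', by rwa [← height_flip]⟩
  · rintro (⟨he, hz⟩ | ⟨he, hz⟩)
    · exact ⟨e, he, rfl, hz⟩
    · exact ⟨_, he, arrival_flip_fst, by rwa [height_flip]⟩

theorem mem_band_iff_of_glue (hA : A ⊆ Set.Ioo (-1) 1) {a b : G.Pieces} (h : G.Glue a b) :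
    a ∈ s.band e₀ A ↔ b ∈ s.band e₀ A := by
  have hentry (e : G.Dart) (t : Set.Ioo (-1 : ℝ) 1) :
      .inl ⟨(arrival e).1, e.entry t⟩ ∈ s.band e₀ A ↔
        e ∈ s.orbit e₀ ∧ (t : ℝ) ∈ A ∨ s.flip e ∈ s.orbit e₀ ∧ -(t : ℝ) ∈ A := by
    have ht : |(t : ℝ)| < 1 := abs_lt.mpr t.2
    rw [inl_mem_band_iff_of_abs_add_abs_height_lt, height_entry]
    intro a ha
    have ha' : |a| < 1 := abs_lt.mpr (hA ha)
    rw [height_entry]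
    linarith
  obtain ⟨e, t, t', ht, rfl, rfl⟩ := h.exists_dart
  rw [hentry, hentry, ht, neg_neg, flip_rev_mem_orbit_iff, ← step_flip, step_mem_orbit_iff,
    or_comm]

theorem toSurface_mem_image_band_iff (hA : A ⊆ Set.Ioo (-1) 1) {a : G.Pieces} :
    toSurface a ∈ toSurface '' s.band e₀ A ↔ a ∈ s.band e₀ A :=
  toSurface_mem_image_iff fun _ _ => mem_band_iff_of_glue hA

theorem isOpen_image_band (hA : A ⊆ Set.Ioo (-1) 1) (hopen : IsOpen A) :
    IsOpen (toSurface '' s.band e₀ A) := by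
  have hband : IsOpen (s.band e₀ A) := isOpen_biUnion fun e _ =>
    (isOpenMap_inl.comp isOpenMap_sigmaMk) _
      (hopen.preimage (s.continuous_height.comp continuous_subtype_val))
  refine isQuotientMap_toSurface.isOpen_preimage.mp ?_
  convert hband using 1
  ext a
  exact toSurface_mem_image_band_iff hA

theorem isCompact_image_band : IsCompact (toSurface '' s.band e₀ {0}) :=
  IsCompact.image (Set.Finite.isCompact_biUnion (Set.toFinite _) fun _ _ =>
    isCompact_height_eq_zero.image (continuous_inl.comp continuous_sigmaMk))
    isQuotientMap_toSurface.continuous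

end PoleState

variable {s : G.PoleState} {e e₀ : G.Dart}

theorem PoleCurve.carrier_through :
    (through e₀ : PoleCurve s).carrier = toSurface '' s.band e₀ {0} := by
  ext x
  simp only [carrier, PoleState.band, Set.image_iUnion, PoleState.mem_orbit_iff, Set.image_image,
    Set.mem_singleton_iff, ← PoleState.mem_plaqueArc_iff, Set.ofPred_mem_eq, Set.mem_iUnion,
    exists_prop, exists_exists_eq_and]
  rfl

theorem PoleCurve.plaquePoint_mem_carrier_iff {z : Plaque} (h : |s.height e z| < 2) :
    plaquePoint (arrival e).1 z ∈ (through e₀ : PoleCurve s).carrier ↔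
      s.height e z = 0 ∧ (e ∈ s.orbit e₀ ∨ s.flip e ∈ s.orbit e₀) := by
  have hzero : ({0} : Set ℝ) ⊆ Set.Ioo (-1) 1 := by simp
  rw [carrier_through, plaquePoint, PoleState.toSurface_mem_image_band_iff hzero,
    PoleState.inl_mem_band_iff_of_abs_add_abs_height_lt (by simpa using h)]
  simp only [Set.mem_singleton_iff, neg_eq_zero]
  tauto

end GaussDiagram

/-! ## Components of the complement of a pole curve -/

/-- `X` contains each preconnected set that meets it and avoids `l`, as a connected component of
the complement of `l` does. Unlike that, the notion is stable under preimages. -/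
def AbsorbsPreconnectedOff {α : Type*} [TopologicalSpace α] (l X : Set α) : Prop :=
  ∀ C, IsPreconnected C → Disjoint C l → (C ∩ X).Nonempty → C ⊆ X

theorem absorbsPreconnectedOff_connectedComponentIn {α : Type*} [TopologicalSpace α] (l : Set α)
    (x : α) : AbsorbsPreconnectedOff l (connectedComponentIn lᶜ x) := by
  rintro C hC hCl ⟨y, hyC, hyX⟩
  rw [connectedComponentIn_eq hyX]
  exact hC.subset_connectedComponentIn hyC hCl.subset_compl_right

theorem AbsorbsPreconnectedOff.preimage {α β : Type*} [TopologicalSpace α] [TopologicalSpace β]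
    {f : α → β} (hf : Continuous f) (hinj : Function.Injective f) {l : Set α} {X : Set β}
    (hX : AbsorbsPreconnectedOff (f '' l) X) : AbsorbsPreconnectedOff l (f ⁻¹' X) := by
  rintro C hC hCl ⟨x, hxC, hxX⟩
  exact Set.image_subset_iff.mp <| hX _ (hC.image f hf.continuousOn)
    ((Set.disjoint_image_iff hinj).mpr hCl) ⟨f x, Set.mem_image_of_mem f hxC, hxX⟩

namespace GaussDiagram

variable {G : GaussDiagram}

/-- A point of the surface on the left of the arc of `e`. -/
noncomputable def leftPoint (e : G.Dart) : G.Surface :=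
  plaquePoint (arrival e).1 (e.entry ⟨1 / 2, by norm_num⟩)

theorem leftPoint_rev (e : G.Dart) :
    leftPoint e.rev = plaquePoint (arrival e).1 (e.entry ⟨-(1 / 2), by norm_num⟩) :=
  plaquePoint_entry_rev e (by norm_num)

variable {s : G.PoleState} {e e₀ : G.Dart}

open PoleState

theorem mem_iff_mem_of_height_mem_Ioo {l X : Set G.Surface} (hX : AbsorbsPreconnectedOff l X)
    {u v : ℝ} {c : G.Crossing}
    (hoff : ∀ z : Plaque, s.height e z ∈ Set.Ioo u v → plaquePoint c z ∉ l) {z w : Plaque}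
    (hz : s.height e z ∈ Set.Ioo u v) (hw : s.height e w ∈ Set.Ioo u v) :
    plaquePoint c z ∈ X ↔ plaquePoint c w ∈ X := by
  have hC := (s.isPreconnected_height_Ioo (e := e) u v).image (plaquePoint c)
    (continuous_plaquePoint c).continuousOn
  have hCl : Disjoint (plaquePoint c '' {z : Plaque | s.height e z ∈ Set.Ioo u v}) l :=
    Set.disjoint_left.mpr (Set.forall_mem_image.mpr hoff)
  have hsub := hX _ hC hCl
  exact ⟨fun h => hsub ⟨_, Set.mem_image_of_mem _ hz, h⟩ (Set.mem_image_of_mem _ hw),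
    fun h => hsub ⟨_, Set.mem_image_of_mem _ hw, h⟩ (Set.mem_image_of_mem _ hz)⟩

namespace PoleCurve

variable {X : Set G.Surface}
  (hX : AbsorbsPreconnectedOff (through e₀ : PoleCurve s).carrier X)
include hX

theorem mem_iff_leftPoint_mem {z : Plaque} (hz : s.height e z ∈ Set.Ioo 0 2) :
    plaquePoint (arrival e).1 z ∈ X ↔ leftPoint e ∈ X :=
  mem_iff_mem_of_height_mem_Ioo hX (fun w hw h => hw.1.ne'
    ((plaquePoint_mem_carrier_iff (abs_lt.mpr ⟨by linarith [hw.1], hw.2⟩)).mp h).1) hz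
    (by rw [height_entry]; norm_num)

theorem leftPoint_step_mem_iff : leftPoint (s.step e) ∈ X ↔ leftPoint e ∈ X := by
  rw [← rev_flip, leftPoint_rev, arrival_flip_fst]
  refine mem_iff_leftPoint_mem hX ?_
  rw [← neg_neg (s.height e _), ← height_flip, height_entry]
  norm_num

theorem leftPoint_rev_mem_iff (he : e ∉ s.orbit e₀) (hflip : s.flip e ∉ s.orbit e₀) :
    leftPoint e.rev ∈ X ↔ leftPoint e ∈ X := by
  rw [leftPoint_rev]
  refine mem_iff_mem_of_height_mem_Ioo hX (e := e) (u := -2) (v := 2) (s := s) (fun z hz h => ?_)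
    (by rw [height_entry]; norm_num) (by rw [height_entry]; norm_num)
  exact ((plaquePoint_mem_carrier_iff (abs_lt.mpr hz)).mp h).2.elim he hflip

theorem leftPoint_mem_iff_center_mem {p : Pole} (hp : s.pole? e = some p) (hside : p.side = .left) :
    leftPoint e ∈ X ↔ plaquePoint (arrival e).1 ⟨0, by simp⟩ ∈ X := by
  refine (mem_iff_leftPoint_mem hX ?_).symm
  simp [height_center_of_pole hp, hside, Side.sign]

theorem leftPoint_rev_mem_iff_of_hasIndex {k : ℕ}
    (hk : HasIndex (through e₀ : PoleCurve s).poles k) (hpos : 0 < k) :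
    leftPoint e₀.rev ∈ X ↔ leftPoint e₀ ∈ X := by
  classical
  by_contra hne
  have hcharge := sum_charge_orbit_eq_zero (s := s) (e₀ := e₀)
    (φ := fun e => if leftPoint e ∈ X then 1 else 0)
    (ψ := fun c => if plaquePoint c ⟨0, by simp⟩ ∈ X then 1 else 0)
    (fun e => by simp only [leftPoint_step_mem_iff hX])
    (fun e p hp hside => by simp only [leftPoint_mem_iff_center_mem hX hp hside])
    (fun e he hflip => by simp only [leftPoint_rev_mem_iff hX he hflip])
    (by grind)
  have habs := hk.two_mul_eq_abs_totalCharge (alternatingPoles _)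
  rw [totalCharge_poles_through, hcharge, abs_zero] at habs
  omega

theorem leftPoint_mem_iff_of_mem_orbit (he : e ∈ s.orbit e₀) :
    leftPoint e ∈ X ↔ leftPoint e₀ ∈ X :=
  (eq_of_mem_orbit (φ := fun e => leftPoint e ∈ X)
    (fun _ => propext (leftPoint_step_mem_iff hX)) he).to_iff

theorem leftPoint_flip_mem_iff_of_mem_orbit (he : e ∈ s.orbit e₀) :
    leftPoint (s.flip e) ∈ X ↔ leftPoint e₀.rev ∈ X := by
  have hflip (e : G.Dart) : leftPoint (s.flip e) ∈ X ↔ leftPoint e.rev ∈ X := by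
    rw [← step_flip, leftPoint_step_mem_iff hX]
  rw [hflip]
  exact (eq_of_mem_orbit (φ := fun e => leftPoint e.rev ∈ X)
    (fun e => propext (hflip e)) he).to_iff

theorem mem_iff_of_mem_band {k : ℕ} (hk : HasIndex (through e₀ : PoleCurve s).poles k)
    (hpos : 0 < k) {x : G.Surface} (hx : x ∈ toSurface '' s.band e₀ (Set.Ioo (-1) 1))
    (hxl : x ∉ (through e₀ : PoleCurve s).carrier) : x ∈ X ↔ leftPoint e₀ ∈ X := by
  obtain ⟨a, ha, rfl⟩ := hx
  obtain ⟨e, he, z, hz, rfl⟩ := Set.mem_iUnion₂.mp ha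
  change plaquePoint _ z ∉ _ at hxl
  change plaquePoint _ z ∈ X ↔ _
  have hlt : |s.height e z| < 2 := (abs_lt.mpr hz).trans one_lt_two
  have hne : s.height e z ≠ 0 := fun h =>
    hxl ((plaquePoint_mem_carrier_iff hlt).mpr ⟨h, .inl he⟩)
  rcases hne.lt_or_gt with hneg | hpos'
  · rw [← arrival_flip_fst (s := s), mem_iff_leftPoint_mem hX (s := s),
      leftPoint_flip_mem_iff_of_mem_orbit hX he, leftPoint_rev_mem_iff_of_hasIndex hX hk hpos]
    rw [height_flip]
    exact ⟨neg_pos.mpr hneg, (neg_le_abs _).trans_lt hlt⟩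
  · rw [mem_iff_leftPoint_mem hX ⟨hpos', (le_abs_self _).trans_lt hlt⟩,
      leftPoint_mem_iff_of_mem_orbit hX he]

end PoleCurve

end GaussDiagram

section Separation

variable {F : Type*} [TopologicalSpace F] [LocallyConnectedSpace F] {l T : Set F}

theorem isOpen_compl_sdiff_connectedComponentIn (hl : IsClosed l) (x : F) :
    IsOpen (lᶜ \ connectedComponentIn lᶜ x) := by
  refine isOpen_iff_mem_nhds.mpr fun z hz => Filter.mem_of_superset
    (hl.isOpen_compl.connectedComponentIn.mem_nhds (mem_connectedComponentIn hz.1)) fun w hw => ?_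
  refine ⟨connectedComponentIn_subset _ _ hw, fun hwx => hz.2 ?_⟩
  rw [connectedComponentIn_eq hwx, ← connectedComponentIn_eq hw]
  exact mem_connectedComponentIn hz.1

theorem not_isSeparating_of_isOpen (hl : IsClosed l) (hT : IsOpen T) (hlT : l ⊆ T)
    (hcomp : ∀ x ∈ T \ l, T \ l ⊆ connectedComponentIn lᶜ x) : ¬IsSeparating l := by
  rintro ⟨x, hx, y, hy, hxy, hne⟩
  set U := connectedComponentIn lᶜ x
  have hU : IsOpen U := hl.isOpen_compl.connectedComponentIn
  have hUl : U ⊆ lᶜ := connectedComponentIn_subset _ _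
  have hxU : x ∈ U := mem_connectedComponentIn hx
  have hyU : y ∉ U := fun h => hne (connectedComponentIn_eq h)
  have hrest : IsOpen (lᶜ \ U) := isOpen_compl_sdiff_connectedComponentIn hl x
  have hclopen {V : Set F} (hV : IsClopen V) (hxV : x ∈ V) : y ∈ V :=
    hV.connectedComponent_subset hxV (hxy ▸ mem_connectedComponent)
  by_cases hdisj : Disjoint (T \ l) U
  · have hcompl : Uᶜ = (lᶜ \ U) ∪ T := by
      rw [Set.disjoint_left] at hdisj
      grind
    exact hyU (hclopen ⟨⟨hcompl ▸ hrest.union hT⟩, hU⟩ hxU)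
  · obtain ⟨z, hzT, hzU⟩ := Set.not_disjoint_iff.mp hdisj
    have hsub : T \ l ⊆ U := by
      rw [show U = _ from connectedComponentIn_eq hzU]
      exact hcomp z hzT
    have hunion : U ∪ l = U ∪ T := by
      rw [← Set.sdiff_union_of_subset hlT, ← Set.union_assoc, Set.union_eq_left.mpr hsub]
    have hcompl : (U ∪ l)ᶜ = lᶜ \ U := by
      rw [Set.compl_union, Set.inter_comm, Set.sdiff_eq]
    exact (hclopen ⟨⟨hcompl ▸ hrest⟩, hunion ▸ hU.union hT⟩ (.inl hxU)).elim hyU hy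

end Separation

open GaussDiagram in
theorem corollary1_general {G : GaussDiagram} {F : Type*} [TopologicalSpace F] [T2Space F]
    [LocallyConnectedSpace F] {f : G.Surface → F} (hf : Topology.IsOpenEmbedding f)
    {s : G.PoleState} (l : PoleCurve s) {k : ℕ} (hk : HasIndex l.poles k)
    (hpos : 0 < k) : ¬IsSeparating (f '' l.carrier) := by
  cases l with
  | free i =>
    have hindex : 2 * (k : ℤ) = |0| := hk.two_mul_eq_abs_totalCharge (PoleCurve.alternatingPoles _)
    rw [abs_zero] at hindex
    omega
  | through e =>
    set l := (PoleCurve.through e : PoleCurve s).carrier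
    set T := toSurface '' s.band e (Set.Ioo (-1) 1)
    have hl : l = toSurface '' s.band e {0} := PoleCurve.carrier_through
    have hlT : l ⊆ T := hl ▸ Set.image_mono (PoleState.band_mono (by simp))
    have hclosed : IsClosed (f '' l) :=
      hl ▸ (PoleState.isCompact_image_band.image hf.continuous).isClosed
    have hT : IsOpen (f '' T) := hf.isOpenMap _ (PoleState.isOpen_image_band subset_rfl isOpen_Ioo)
    refine not_isSeparating_of_isOpen hclosed hT (Set.image_mono hlT) ?_
    rw [← Set.image_sdiff hf.injective, Set.forall_mem_image]
    intro x hx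
    have hX := (absorbsPreconnectedOff_connectedComponentIn (f '' l) (f x)).preimage hf.continuous
      hf.injective
    have hxX : f x ∈ connectedComponentIn (f '' l)ᶜ (f x) :=
      mem_connectedComponentIn (mt hf.injective.mem_set_image.mp hx.2)
    exact Set.image_subset_iff.mpr fun y hy =>
      (PoleCurve.mem_iff_of_mem_band hX hk hpos hy.1 hy.2).mpr
        ((PoleCurve.mem_iff_of_mem_band hX hk hpos hx.1 hx.2).mp hxX)

theorem corollary1 (D : VirtualLinkDiagram) {F : Type*} [TopologicalSpace F] [T2Space F]
    [CompactSpace F] [ChartedSpace (EuclideanSpace ℝ (Fin 2)) F] (f : D.Realization F)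
    (s : D.gaussDiagram.PoleState) (l : GaussDiagram.PoleCurve s) (k : ℕ)
    (hk : HasIndex l.poles k) (hpos : 0 < k) :
    ¬ IsSeparating (f.toFun '' l.carrier) := by
  have := ChartedSpace.locallyConnectedSpace (EuclideanSpace ℝ (Fin 2)) F
  exact corollary1_general f.isOpenEmbedding l hk hpos
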